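/- Let $\alpha>0$ and $0\le m<s<M$. Let $\mathcal F(m,M,s)$ be the class of heat sources $f\in L^1[-\pi,\pi]$ with $m\le f\le M$ a.e. on $[-\pi,\pi]$ and $\|f\|_{L^1}=2\pi s$. For $f\in L^1[-\pi,\pi]$ let $u_f\in C^1[-\pi,\pi]$ be the solution of the Robin problem: $u_f'$ is absolutely continuous on $[-\pi,\pi]$, $-u_f''=f$ a.e. on $(-\pi,\pi)$, and $-u_f'(-\pi)+\alpha u_f(-\pi)=u_f'(\pi)+\alpha u_f(\pi)=0$. Write $\operatorname{osc}(u)=\max_{[-\pi,\pi]}u-\min_{[-\pi,\pi]}u$ and $I(a,l)=[a-l,a+l]$. Put $$l=\frac{\pi(s-m)}{M-m},\qquad \delta=\frac{m}{M-m},\qquad c_\alpha=\frac{\alpha}{1+\alpha\pi},$$ $$\alpha_0=\frac{-2\pi^2\delta+3\pi\delta l-\pi l+2l^2+l\sqrt{(1+\delta)(\pi^2\delta+9\pi^2-16\pi l+8l^2)}}{2(\pi^3\delta-\pi^2\delta l+2\pi^2l-3\pi l^2+l^3)},$$ $$\alpha_g=\begin{cases}\alpha_0,&(1+\delta)l>\delta(\pi-l),\\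 0,&(1+\delta)l\le\delta(\pi-l),\end{cases}\qquad a_g=\begin{cases}\pi-l,&0<\alpha\le\alpha_g,\\[2pt] \dfrac{(1+\delta)l}{(1+\alpha\pi)(\delta+2lc_\alpha-l^2c_\alpha^2)},&\alpha>\alpha_g,\end{cases}$$ $$\Theta_\alpha(l,\delta)=\begin{cases}\dfrac{(l^2c_\alpha^2-2lc_\alpha-\delta)(\pi-l)^2}{2(1+\delta)}+\dfrac{l(\pi-l)}{1+\alpha\pi}+\pi l+\dfrac{\pi^2\delta}{2}-\dfrac{l^2}{2},&0<\alpha\le\alpha_g,\\[8pt] \dfrac{(1+\delta)l^2}{2\left[(\pi^2\delta+2\pi l-l^2)\alpha^2+2(\pi\delta+l)\alpha+\delta\right]}+\pi l+\dfrac{\pi^2\delta}{2}-\dfrac{l^2}{2},&\alpha>\alpha_g.\end{cases}$$ Then $\Theta_\alpha(l,\delta)=\max_{a\in[0,\pi-l]}\operatorname{osc}(u_{\delta+\chi_{I(a,l)}})$, and for every $f\in\mathcal F(m,M,s)$ $$\operatorname{osc}(u_f)\le (M-m)\,\Theta_\alpha(l,\delta).$$ Equality holds if and only if $f(x)=f_0(x)$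 for a.e. $x\in[-\pi,\pi]$ or $f(x)=f_0(-x)$ for a.e. $x\in[-\pi,\pi]$, where $f_0=m+(M-m)\chi_{I(a_g,l)}$. -/

import Mathlib

open Real MeasureTheory Set

noncomputable section

/-- `u` solves the Robin problem on `[-π, π]` with heat source `f` and Robin parameter `α`:
`u ∈ C¹[-π, π]`, `u'` is absolutely continuous on `[-π, π]`, `-u'' = f` almost everywhere on
`(-π, π)`, and `-u'(-π) + α u(-π) = u'(π) + α u(π) = 0`. The derivatives at the end points
are one-sided, so only the values of `u` on `[-π, π]` matter. -/
structure IsRobinSolution (α : ℝ) (f u : ℝ → ℝ) : Prop where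
  contDiffOn : ContDiffOn ℝ 1 u (Icc (-π) π)
  absolutelyContinuous :
    AbsolutelyContinuousOnInterval (derivWithin u (Icc (-π) π)) (-π) π
  neg_deriv_deriv : ∀ᵐ x ∂(volume.restrict (Ioo (-π) π)),
    HasDerivAt (derivWithin u (Icc (-π) π)) (-f x) x
  boundary_left : -derivWithin u (Icc (-π) π) (-π) + α * u (-π) = 0
  boundary_right : derivWithin u (Icc (-π) π) π + α * u π = 0

/-- The class `𝓕(m, M, s)` of heat sources: `f ∈ L¹[-π, π]`, `m ≤ f ≤ M` (almost everywhere)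
and `‖f‖_{L¹} = 2πs`. -/
structure IsHeatSource (m M s : ℝ) (f : ℝ → ℝ) : Prop where
  integrableOn : IntegrableOn f (Icc (-π) π)
  bounds : ∀ᵐ x ∂(volume.restrict (Icc (-π) π)), m ≤ f x ∧ f x ≤ M
  norm_eq : ∫ x in Icc (-π) π, |f x| = 2 * π * s

/-- The oscillation (temperature gap) of `u` over `[-π, π]`. -/
def rodOsc (u : ℝ → ℝ) : ℝ :=
  sSup (u '' Icc (-π) π) - sInf (u '' Icc (-π) π)

/-- The heat source `p + q χ_{I(a, l)}`, where `I(a, l) = [a - l, a + l]`. -/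
def intervalSource (p q a l : ℝ) : ℝ → ℝ :=
  fun x => p + q * (Icc (a - l) (a + l)).indicator (fun _ => (1 : ℝ)) x

/-- `c_α = α / (1 + απ)`. -/
def robinC (α : ℝ) : ℝ := α / (1 + α * π)

/-- The transitional value `α₀(l, δ)` of the Robin parameter. -/
def robinAlpha0 (l δ : ℝ) : ℝ :=
  (-2 * π ^ 2 * δ + 3 * π * δ * l - π * l + 2 * l ^ 2
      + l * √((1 + δ) * (π ^ 2 * δ + 9 * π ^ 2 - 16 * π * l + 8 * l ^ 2)))
    / (2 * (π ^ 3 * δ - π ^ 2 * δ * l + 2 * π ^ 2 * l - 3 * π * l ^ 2 + l ^ 3))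

/-- The threshold `α_g(l, δ)`. -/
def robinAlphaG (l δ : ℝ) : ℝ :=
  if (1 + δ) * l > δ * (π - l) then robinAlpha0 l δ else 0

/-- The stationary centre `a₀`. -/
def robinA0 (α l δ : ℝ) : ℝ :=
  (1 + δ) * l /
    ((1 + α * π) * (δ + 2 * l * robinC α - l ^ 2 * robinC α ^ 2))

/-- The centre `a_g` of the optimal interval: `π - l` up to the threshold, `a₀` beyond it. -/
def robinAG (α l δ : ℝ) : ℝ :=
  if α ≤ robinAlphaG l δ then π - l else robinA0 α l δ

/-- The maximal temperature gap `Θ_α(l, δ)` for a single interval. -/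
def robinTheta (α l δ : ℝ) : ℝ :=
  if α ≤ robinAlphaG l δ then
    (1 / 2) * ((l ^ 2 * robinC α ^ 2 - 2 * l * robinC α - δ) * (π - l) ^ 2 / (1 + δ))
      + l * (π - l) / (1 + α * π) + π * l + π ^ 2 * δ / 2 - l ^ 2 / 2
  else
    (1 / 2) * ((1 + δ) * l ^ 2 /
        ((π ^ 2 * δ + 2 * π * l - l ^ 2) * α ^ 2 + 2 * (π * δ + l) * α + δ))
      + π * l + π ^ 2 * δ / 2 - l ^ 2 / 2

end

/-! A solution with nonnegative source lies above its chord, so its minimum is at an end point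
(`IsRobinSolution.min_endpoints_le`), and after the reflection `x ↦ -x` only gaps `u x - u (-π)`
matter. The Green function turns such a gap into the integral of `f` against `gapKernel c x`. For
fixed `x > -π` this kernel is a tent in `y`: it increases up to `x` and decreases after it. Its
superlevel sets are therefore intervals, and the bathtub principle makes a single interval of length
`2l` the unique optimal shape (`integral_gapKernel_mul_le`).

What remains is finite-dimensional. For a source `m + (M - m) χ_{I(a,l)}` and `x` in the interval,
the gap is `M - m` times an explicit function, a constant plus the quadratic `gapQuad` in `(x, a)`.
This quadratic is strictly concave and is maximised under `a ≤ π - l`: the maximiser is the critical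
point, or has `a = π - l` when the critical point violates the constraint. The threshold `α_g`
separates the two cases (`robinAlphaG_spec`), and completing squares gives both the value and
uniqueness (`gapQuad_le`). Uniqueness in both steps yields the equality cases. -/

theorem AbsolutelyContinuousOnInterval.congr_eqOn {f g : ℝ → ℝ} {a b : ℝ}
    (hf : AbsolutelyContinuousOnInterval f a b) (h : EqOn f g (uIcc a b)) :
    AbsolutelyContinuousOnInterval g a b := by
  rw [absolutelyContinuousOnInterval_iff] at hf ⊢
  intro ε hε
  obtain ⟨η, hη, H⟩ := hf ε hε
  refine ⟨η, hη, fun E hE hlt => ?_⟩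
  convert H E hE hlt using 1
  refine Finset.sum_congr rfl fun i hi => ?_
  have := hE.1 i hi
  rw [h this.1, h this.2]

theorem deriv_affine_real (A B x : ℝ) : deriv (fun y : ℝ => A + B * y) x = B := by
  simp

theorem absolutelyContinuousOnInterval_affine (A B p q : ℝ) :
    AbsolutelyContinuousOnInterval (fun y : ℝ => A + B * y) p q := by
  have h : LipschitzWith (Real.nnabs B) (fun y : ℝ => A + B * y) := by
    refine LipschitzWith.of_dist_le_mul fun x y => ?_
    rw [Real.dist_eq, Real.dist_eq, ← Real.norm_eq_abs, ← Real.norm_eq_abs]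
    simp [← mul_sub]
  exact h.lipschitzOnWith.absolutelyContinuousOnInterval

/-! ### Green representation and existence of solutions. -/

namespace IsRobinSolution

variable {α : ℝ} {f u : ℝ → ℝ}

theorem hasDerivAt (h : IsRobinSolution α f u) {x : ℝ} (hx : x ∈ Ioo (-π) π) :
    HasDerivAt u (derivWithin u (Icc (-π) π) x) x := by
  have hd := h.contDiffOn.differentiableOn (by norm_num) x (Ioo_subset_Icc_self hx)
  exact hd.hasDerivWithinAt.hasDerivAt (Icc_mem_nhds hx.1 hx.2)

/-- Integration by parts against an affine function. -/
theorem integral_affine_mul (h : IsRobinSolution α f u) (A B : ℝ) {p q : ℝ}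
    (hp : -π ≤ p) (hpq : p ≤ q) (hq : q ≤ π) :
    ∫ y in p..q, (A + B * y) * f y =
      (A + B * p) * derivWithin u (Icc (-π) π) p - (A + B * q) * derivWithin u (Icc (-π) π) q
        + B * (u q - u p) := by
  set v := derivWithin u (Icc (-π) π) with hv
  have hsub : uIcc p q ⊆ uIcc (-π) π := by
    rw [uIcc_of_le hpq, uIcc_of_le (by linarith)]
    exact Icc_subset_Icc hp hq
  have hac : AbsolutelyContinuousOnInterval v p q := h.absolutelyContinuous.mono hsub
  have hparts := (absolutelyContinuousOnInterval_affine A B p q).integral_mul_deriv_eq_deriv_mul hac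
  have hleft : ∫ y in p..q, (A + B * y) * f y = -∫ y in p..q, (A + B * y) * deriv v y := by
    rw [← intervalIntegral.integral_neg]
    apply intervalIntegral.integral_congr_ae
    have hae := (ae_restrict_iff' measurableSet_Ioo).1 h.neg_deriv_deriv
    -- The equation is known on the open interval only, while the integral runs over `Ioc p q`,
    -- which may contain `π`.
    have hne : ∀ᵐ y : ℝ, y ≠ π := by simp [ae_iff, measure_singleton]
    filter_upwards [hae, hne] with y hy hyπ hyI
    rw [uIoc_of_le hpq] at hyI
    rw [(hy ⟨by linarith [hyI.1], lt_of_le_of_ne (hyI.2.trans hq) hyπ⟩).deriv]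
    ring
  have hftc : ∫ y in p..q, v y = u q - u p := by
    apply intervalIntegral.integral_eq_sub_of_hasDerivAt_of_le hpq
    · exact h.contDiffOn.continuousOn.mono (Icc_subset_Icc hp hq)
    · exact fun x hx => h.hasDerivAt ⟨by linarith [hx.1], by linarith [hx.2]⟩
    · exact hac.continuousOn.intervalIntegrable
  simp only [deriv_affine_real, intervalIntegral.integral_const_mul, hftc] at hparts
  rw [hleft, hparts]
  ring

end IsRobinSolution

/-- The Green function of the Robin problem on `[-π, π]`. -/
noncomputable def robinGreen (α x y : ℝ) : ℝ :=
  (1 + α * π) / (2 * α) - |x - y| / 2 - robinC α * x * y / 2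

theorem continuous_robinGreen (α x : ℝ) : Continuous (robinGreen α x) := by
  unfold robinGreen; fun_prop

/-- The kernel is affine in `y` on each side of `x`, so integration by parts on the two pieces
leaves only boundary terms. The Robin conditions remove those at `±π`, and the slope jump at `x`
produces `u x`. -/
theorem IsRobinSolution.eq_integral_robinGreen {α : ℝ} {f u : ℝ → ℝ} (hα : 0 < α)
    (hf : IntervalIntegrable f volume (-π) π) (h : IsRobinSolution α f u) {x : ℝ}
    (hx : x ∈ Icc (-π) π) : u x = ∫ y in (-π)..π, robinGreen α x y * f y := by
  have hint : IntervalIntegrable (fun y => robinGreen α x y * f y) volume (-π) π :=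
    hf.continuousOn_mul (continuous_robinGreen α x).continuousOn
  have hππ : -π ≤ π := by linarith [pi_pos]
  rw [← intervalIntegral.integral_add_adjacent_intervals
    (hint.mono_set (c := -π) (d := x) ?_) (hint.mono_set (c := x) (d := π) ?_)]
  rotate_left
  · rw [uIcc_of_le hx.1, uIcc_of_le hππ]; exact Icc_subset_Icc le_rfl hx.2
  · rw [uIcc_of_le hx.2, uIcc_of_le hππ]; exact Icc_subset_Icc hx.1 le_rfl
  have h1 : ∫ y in (-π)..x, robinGreen α x y * f y =
      ∫ y in (-π)..x, (((1 + α * π) / (2 * α) - x / 2) + (1 - robinC α * x) / 2 * y) * f y := by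
    apply intervalIntegral.integral_congr
    intro y hy
    rw [uIcc_of_le hx.1] at hy
    simp only [robinGreen, abs_of_nonneg (sub_nonneg.2 hy.2)]
    ring
  have h2 : ∫ y in x..π, robinGreen α x y * f y =
      ∫ y in x..π, (((1 + α * π) / (2 * α) + x / 2) + (-(1 + robinC α * x) / 2) * y) * f y := by
    apply intervalIntegral.integral_congr
    intro y hy
    rw [uIcc_of_le hx.2] at hy
    simp only [robinGreen, abs_of_nonpos (sub_nonpos.2 hy.1)]
    ring
  rw [h1, h2, h.integral_affine_mul _ _ le_rfl hx.1 hx.2, h.integral_affine_mul _ _ hx.1 hx.2 le_rfl]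
  have hl : derivWithin u (Icc (-π) π) (-π) = α * u (-π) := by linarith [h.boundary_left]
  have hr : derivWithin u (Icc (-π) π) π = -(α * u π) := by linarith [h.boundary_right]
  have hπ := pi_pos
  rw [hl, hr, robinC]
  field_simp
  ring

theorem exists_isRobinSolution {α : ℝ} {f : ℝ → ℝ} (hα : 0 < α) (hf : LocallyIntegrable f) :
    ∃ u, IsRobinSolution α f u := by
  have hπ := pi_pos
  have hfi (a b : ℝ) : IntervalIntegrable f volume a b :=
    (hf.integrableOn_isCompact isCompact_uIcc).intervalIntegrable
  set F : ℝ → ℝ := fun x => ∫ t in (-π)..x, f t with hF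
  have hFc : Continuous F := intervalIntegral.continuous_primitive hfi _
  set H : ℝ → ℝ := fun x => ∫ t in (-π)..x, F t with hH
  have hHd (x : ℝ) : HasDerivAt H (F x) x :=
    intervalIntegral.integral_hasDerivAt_right (hFc.intervalIntegrable _ _)
      (hFc.stronglyMeasurableAtFilter _ _) hFc.continuousAt
  -- `A` is the slope at `-π`. The left condition then forces `u (-π) = A / α`, and the right
  -- condition determines `A`.
  set A : ℝ := (F π + α * H π) / (2 + 2 * π * α) with hA
  set u : ℝ → ℝ := fun x => A / α + A * (x + π) - H x with hu
  have hud (x : ℝ) : HasDerivAt u (A - F x) x := by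
    have : HasDerivAt u (A * 1 - F x) x :=
      ((((hasDerivAt_id x).add_const π).const_mul A).const_add (A / α)).sub (hHd x)
    rwa [mul_one] at this
  have huD : Differentiable ℝ u := fun x => (hud x).differentiableAt
  have hdw {x : ℝ} (hx : x ∈ Icc (-π) π) : derivWithin u (Icc (-π) π) x = A - F x :=
    (hud x).hasDerivWithinAt.derivWithin (uniqueDiffOn_Icc (by linarith) x hx)
  have hIcc : uIcc (-π) π = Icc (-π) π := uIcc_of_le (by linarith)
  have hHl : H (-π) = 0 := by simp [hH]
  have hFl : F (-π) = 0 := by simp [hF]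
  refine ⟨u, ?_, ?_, ?_, ?_, ?_⟩
  · have : ContDiff ℝ 1 u := by
      rw [contDiff_one_iff_deriv]
      refine ⟨huD, ?_⟩
      have : deriv u = fun x => A - F x := funext fun x => (hud x).deriv
      rw [this]
      fun_prop
    exact this.contDiffOn
  · have hac : AbsolutelyContinuousOnInterval F (-π) π :=
      (hfi (-π) π).absolutelyContinuousOnInterval_intervalIntegral (by simp)
    have hc : AbsolutelyContinuousOnInterval (fun y : ℝ => A + 0 * y) (-π) π :=
      absolutelyContinuousOnInterval_affine A 0 _ _
    refine (hc.sub hac).congr_eqOn fun x hx => ?_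
    rw [hIcc] at hx
    rw [hdw hx]
    simp
  · rw [ae_restrict_iff' measurableSet_Ioo]
    filter_upwards [LocallyIntegrable.ae_hasDerivAt_integral hf] with x hx hxI
    have : HasDerivAt (fun y => A - F y) (-f x) x := (hx (-π)).const_sub A
    refine this.congr_of_eventuallyEq ?_
    filter_upwards [Icc_mem_nhds hxI.1 hxI.2] with y hy using hdw hy
  · rw [hdw ⟨le_rfl, by linarith⟩]
    simp only [hu, hHl, hFl]
    field_simp
    ring
  · rw [hdw ⟨by linarith, le_rfl⟩]
    simp only [hu, hA]
    have : 2 + 2 * π * α ≠ 0 := by positivity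
    field_simp
    ring

/-! ### The minimum at an end point. -/

/-- A Robin solution with nonnegative source lies above its chord. -/
theorem IsRobinSolution.chord_le {α : ℝ} {f u : ℝ → ℝ} (hα : 0 < α)
    (hf : IntervalIntegrable f volume (-π) π) (h : IsRobinSolution α f u)
    (hf0 : ∀ᵐ y ∂(volume.restrict (Icc (-π) π)), 0 ≤ f y) {t : ℝ} (ht : t ∈ Icc (-π) π) :
    (π - t) * u (-π) + (π + t) * u π ≤ 2 * π * u t := by
  have hπ := pi_pos
  rw [h.eq_integral_robinGreen hα hf ht, h.eq_integral_robinGreen hα hf ⟨le_rfl, by linarith⟩,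
    h.eq_integral_robinGreen hα hf ⟨by linarith, le_rfl⟩,
    ← intervalIntegral.integral_const_mul, ← intervalIntegral.integral_const_mul,
    ← intervalIntegral.integral_const_mul]
  have hint (x : ℝ) : IntervalIntegrable (fun y => robinGreen α x y * f y) volume (-π) π :=
    hf.continuousOn_mul (continuous_robinGreen α x).continuousOn
  rw [← intervalIntegral.integral_add ((hint _).const_mul _) ((hint _).const_mul _)]
  apply intervalIntegral.integral_mono_ae_restrict (by linarith)
    (((hint _).const_mul _).add ((hint _).const_mul _)) ((hint _).const_mul _)
  filter_upwards [hf0] with y hy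
  have key : (π - t) * robinGreen α (-π) y + (π + t) * robinGreen α π y ≤
      2 * π * robinGreen α t y := by
    -- All other terms of the kernel are affine in the first variable, so only the convexity of the
    -- absolute value is needed.
    have habs : 2 * π * |t - y| ≤ (π - t) * |-π - y| + (π + t) * |π - y| := by
      have e1 := abs_add_le ((π - t) * (-π - y)) ((π + t) * (π - y))
      rw [abs_mul, abs_mul, abs_of_nonneg (by linarith [ht.2] : 0 ≤ π - t),
        abs_of_nonneg (by linarith [ht.1] : 0 ≤ π + t)] at e1
      have e2 : (π - t) * (-π - y) + (π + t) * (π - y) = 2 * π * (t - y) := by ring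
      rwa [e2, abs_mul, abs_of_pos (by linarith : 0 < 2 * π)] at e1
    simp only [robinGreen]
    linarith
  nlinarith [mul_le_mul_of_nonneg_right key hy]

theorem IsRobinSolution.min_endpoints_le {α : ℝ} {f u : ℝ → ℝ} (hα : 0 < α)
    (hf : IntervalIntegrable f volume (-π) π) (h : IsRobinSolution α f u)
    (hf0 : ∀ᵐ y ∂(volume.restrict (Icc (-π) π)), 0 ≤ f y) {t : ℝ} (ht : t ∈ Icc (-π) π) :
    u (-π) ≤ u t ∨ u π ≤ u t := by
  have := h.chord_le hα hf hf0 ht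
  by_contra! hcon
  rcases ht with ⟨h1, h2⟩
  have hπ := pi_pos
  rcases h1.eq_or_lt with rfl | h1
  · exact hcon.1.false
  · nlinarith [mul_nonneg (sub_nonneg.2 h2) (sub_pos.2 hcon.1).le,
      mul_pos (by linarith : 0 < π + t) (sub_pos.2 hcon.2)]

/-! ### Bathtub principle and interval sources. -/

/-- The bathtub principle: if `g` and `f` have the same mass and `g - f` has the sign of `h - t`
where it does not vanish, then `g` beats `f` when integrated against `h`, strictly unless the two
agree almost everywhere. -/
theorem integral_mul_le_of_bathtub {Ω : Type*} [MeasurableSpace Ω] {ν : Measure Ω}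
    {f g h : Ω → ℝ} {t : ℝ} (hf : Integrable f ν) (hg : Integrable g ν)
    (hhf : Integrable (fun y => h y * f y) ν) (hhg : Integrable (fun y => h y * g y) ν)
    (hmass : ∫ y, f y ∂ν = ∫ y, g y ∂ν)
    (hsign : ∀ᵐ y ∂ν, f y = g y ∨ 0 < (h y - t) * (g y - f y)) :
    ∫ y, h y * f y ∂ν ≤ ∫ y, h y * g y ∂ν ∧
      (∫ y, h y * f y ∂ν = ∫ y, h y * g y ∂ν → f =ᵐ[ν] g) := by
  have hint : Integrable (fun y => (h y - t) * (g y - f y)) ν := by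
    have := (hhg.sub hhf).sub ((hg.sub hf).const_mul t)
    refine this.congr (Filter.Eventually.of_forall fun y => ?_)
    simp only [Pi.sub_apply]
    ring
  have hval : ∫ y, (h y - t) * (g y - f y) ∂ν = ∫ y, h y * g y ∂ν - ∫ y, h y * f y ∂ν := by
    have e : ∫ y, (h y - t) * (g y - f y) ∂ν =
        ∫ y, (h y * g y - h y * f y) - t * (g y - f y) ∂ν := by
      congr 1; ext y; ring
    have i1 : Integrable (fun y => h y * g y - h y * f y) ν := hhg.sub hhf
    have i2 : Integrable (fun y => t * (g y - f y)) ν := (hg.sub hf).const_mul t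
    rw [e, integral_sub i1 i2, integral_sub hhg hhf, integral_const_mul, integral_sub hg hf, hmass]
    ring
  have hnn : 0 ≤ᵐ[ν] fun y => (h y - t) * (g y - f y) := by
    filter_upwards [hsign] with y hy
    rcases hy with hy | hy
    · simp [hy]
    · exact hy.le
  refine ⟨by linarith [integral_nonneg_of_ae hnn], fun heq => ?_⟩
  have h0 := (integral_eq_zero_iff_of_nonneg_ae hnn hint).1 (by rw [hval, heq, sub_self])
  filter_upwards [hsign, h0] with y hy hy0
  rcases hy with hy | hy
  · exact hy
  · exact absurd hy0 hy.ne'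

theorem integrableOn_intervalSource (p q a l : ℝ) :
    IntegrableOn (intervalSource p q a l) (Icc (-π) π) := by
  unfold intervalSource
  have h1 : Integrable ((Icc (a - l) (a + l)).indicator (fun _ => (1 : ℝ))) :=
    (integrable_indicator_iff measurableSet_Icc).2 (by simp)
  exact (integrableOn_const (by simp)).add (h1.integrableOn.const_mul q)

theorem locallyIntegrable_intervalSource (p q a l : ℝ) :
    LocallyIntegrable (intervalSource p q a l) := by
  unfold intervalSource
  have h1 : Integrable ((Icc (a - l) (a + l)).indicator (fun _ => (1 : ℝ))) :=
    (integrable_indicator_iff measurableSet_Icc).2 (by simp)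
  exact (locallyIntegrable_const p).add (h1.const_mul q).locallyIntegrable

/-- Integration of a continuous function against an interval source. -/
theorem integral_mul_intervalSource {h : ℝ → ℝ} (hh : Continuous h) (p q : ℝ) {a l : ℝ}
    (hl : 0 ≤ l) (h1 : -π ≤ a - l) (h2 : a + l ≤ π) :
    ∫ y in Icc (-π) π, h y * intervalSource p q a l y =
      p * (∫ y in (-π)..π, h y) + q * ∫ y in (a - l)..(a + l), h y := by
  have hsub : Icc (a - l) (a + l) ⊆ Icc (-π) π := Icc_subset_Icc h1 h2
  have e (y : ℝ) : h y * intervalSource p q a l y =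
      p * h y + q * (Icc (a - l) (a + l)).indicator h y := by
    unfold intervalSource
    by_cases hy : y ∈ Icc (a - l) (a + l)
    · simp only [indicator_of_mem hy]; ring
    · simp only [indicator_of_notMem hy]; ring
  have hi : IntegrableOn h (Icc (-π) π) := hh.continuousOn.integrableOn_compact isCompact_Icc
  simp only [e]
  rw [integral_add (hi.const_mul p)
    ((hi.indicator measurableSet_Icc).const_mul q), integral_const_mul, integral_const_mul,
    setIntegral_indicator measurableSet_Icc, inter_eq_self_of_subset_right hsub,
    integral_Icc_eq_integral_Ioc, integral_Icc_eq_integral_Ioc,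
    ← intervalIntegral.integral_of_le (by linarith [pi_pos]),
    ← intervalIntegral.integral_of_le (by linarith)]

theorem integral_intervalSource (p q : ℝ) {a l : ℝ} (hl : 0 ≤ l) (h1 : -π ≤ a - l)
    (h2 : a + l ≤ π) :
    ∫ y in Icc (-π) π, intervalSource p q a l y = 2 * π * p + 2 * l * q := by
  have := integral_mul_intervalSource (h := fun _ => 1) continuous_const p q hl h1 h2
  simp only [one_mul, intervalIntegral.integral_const, smul_eq_mul, mul_one] at this
  rw [this]
  ring

/-! ### The gap kernel and its integrals. -/

/-- The kernel expressing `u x - u (-π)` through the heat source. -/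
noncomputable def gapKernel (c x y : ℝ) : ℝ := (π + y - |x - y| - c * (x + π) * y) / 2

theorem continuous_gapKernel (c x : ℝ) : Continuous (gapKernel c x) := by
  unfold gapKernel; fun_prop

theorem integral_abs_sub_eq {x p q : ℝ} (hp : p ≤ x) (hq : x ≤ q) :
    ∫ y in p..q, |x - y| = ((x - p) ^ 2 + (q - x) ^ 2) / 2 := by
  have hc : Continuous fun y : ℝ => |x - y| := by fun_prop
  have hP (s t : ℝ) : ∫ y in s..t, (x - y) = ((x - s) ^ 2 - (x - t) ^ 2) / 2 := by
    rw [intervalIntegral.integral_sub (by simp) (by simp), integral_id]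
    simp only [intervalIntegral.integral_const, smul_eq_mul]
    ring
  rw [← intervalIntegral.integral_add_adjacent_intervals (hc.intervalIntegrable p x)
    (hc.intervalIntegrable x q)]
  have h1 : ∫ y in p..x, |x - y| = ∫ y in p..x, (x - y) := by
    apply intervalIntegral.integral_congr
    intro y hy
    rw [uIcc_of_le hp] at hy
    exact abs_of_nonneg (sub_nonneg.2 hy.2)
  have h2 : ∫ y in x..q, |x - y| = ∫ y in x..q, -(x - y) := by
    apply intervalIntegral.integral_congr
    intro y hy
    rw [uIcc_of_le hq] at hy
    exact abs_of_nonpos (sub_nonpos.2 hy.1)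
  rw [h1, h2, intervalIntegral.integral_neg, hP, hP]
  ring

theorem integral_gapKernel {c x p q : ℝ} (hp : p ≤ x) (hq : x ≤ q) :
    ∫ y in p..q, gapKernel c x y =
      (π * (q - p) + (1 - c * (x + π)) * (q ^ 2 - p ^ 2) / 2
        - ((x - p) ^ 2 + (q - x) ^ 2) / 2) / 2 := by
  have e (y : ℝ) : gapKernel c x y = (π + (1 - c * (x + π)) * y - |x - y|) / 2 := by
    unfold gapKernel; ring
  have hc : Continuous fun y : ℝ => |x - y| := by fun_prop
  have hl : Continuous fun y : ℝ => π + (1 - c * (x + π)) * y := by fun_prop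
  simp only [e]
  rw [intervalIntegral.integral_div, intervalIntegral.integral_sub (hl.intervalIntegrable _ _)
    (hc.intervalIntegrable _ _), integral_abs_sub_eq hp hq,
    intervalIntegral.integral_add (by simp) (Continuous.intervalIntegrable (by fun_prop) _ _),
    intervalIntegral.integral_const_mul, integral_id]
  simp only [intervalIntegral.integral_const, smul_eq_mul]
  ring

/-- The gap between the points `x` and `-π` produced by `δ + χ_{I(a,l)}`, up to the constant
`πl + π²δ/2 - l²/2`. -/
noncomputable def gapQuad (c l δ x a : ℝ) : ℝ :=
  -((1 + δ) * x ^ 2) / 2 - a ^ 2 / 2 + (1 - c * l) * a * x + l * (1 - c * π) * a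

theorem integral_gapKernel_mul_intervalSource (c q δ : ℝ) {a l x : ℝ} (hl : 0 ≤ l)
    (h1 : -π ≤ a - l) (h2 : a + l ≤ π) (hx1 : a - l ≤ x) (hx2 : x ≤ a + l) :
    ∫ y in Icc (-π) π, gapKernel c x y * intervalSource (q * δ) q a l y =
      q * (π * l + π ^ 2 * δ / 2 - l ^ 2 / 2 + gapQuad c l δ x a) := by
  rw [integral_mul_intervalSource (continuous_gapKernel c x) _ _ hl h1 h2,
    integral_gapKernel (by linarith) (by linarith), integral_gapKernel hx1 hx2, gapQuad]
  ring

/-! ### The best interval for a fixed hot point. -/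

/-- The centre of the interval of length `2l` that is best for the gap between `x` and `-π`. -/
noncomputable def bestCentre (c l x : ℝ) : ℝ := min (x + l * (1 - c * (x + π))) (π - l)

section BestCentre

variable {c l x : ℝ}

/-- No cap is needed on the left: before capping, the left end exceeds `-π` by `(x + π) * (1 - c *
l) ≥ 0`. That `x` lies in the interval is what makes the `gapQuad` formula applicable. -/
theorem bestCentre_mem (hl : 0 < l) (hlπ : l < π) (hc : 0 < c) (hcπ : c * π < 1)
    (hx : -π ≤ x) (hxπ : x ≤ π) :
    -π ≤ bestCentre c l x - l ∧ bestCentre c l x + l ≤ π ∧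
      bestCentre c l x - l ≤ x ∧ x ≤ bestCentre c l x + l := by
  have hcl : c * l < 1 := by nlinarith
  have hk0 : 0 ≤ c * (x + π) := mul_nonneg hc.le (by linarith)
  have hk2 : c * (x + π) ≤ 2 := by nlinarith
  have hk1 : 0 ≤ (x + π) * (1 - c * l) := mul_nonneg (by linarith) (by linarith)
  unfold bestCentre
  rcases min_cases (x + l * (1 - c * (x + π))) (π - l) with ⟨h, h'⟩ | ⟨h, h'⟩ <;> rw [h] <;>
    refine ⟨?_, ?_, ?_, ?_⟩ <;> nlinarith [mul_nonneg hl.le hk0, mul_nonneg hl.le (sub_nonneg.2 hk2)]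

theorem gapKernel_of_le {y : ℝ} (h : y ≤ x) :
    gapKernel c x y = (π - x) / 2 + (1 - c * (x + π) / 2) * y := by
  rw [gapKernel, abs_of_nonneg (sub_nonneg.2 h)]; ring

theorem gapKernel_of_ge {y : ℝ} (h : x ≤ y) :
    gapKernel c x y = (π + x) / 2 - c * (x + π) / 2 * y := by
  rw [gapKernel, abs_of_nonpos (sub_nonpos.2 h)]; ring

/-- The interval around the best centre is a superlevel set of the kernel. -/
theorem gapKernel_level (hl : 0 < l) (hlπ : l < π) (hc : 0 < c) (hcπ : c * π < 1)
    (hx : -π < x) (hxπ : x ≤ π) :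
    (∀ y ∈ Ioo (bestCentre c l x - l) (bestCentre c l x + l),
      gapKernel c x (bestCentre c l x - l) < gapKernel c x y) ∧
    ∀ y ∈ Icc (-π) π, y ∉ Icc (bestCentre c l x - l) (bestCentre c l x + l) →
      gapKernel c x y < gapKernel c x (bestCentre c l x - l) := by
  obtain ⟨-, h2, h3, h4⟩ := bestCentre_mem hl hlπ hc hcπ hx.le hxπ
  have hk0 : 0 < c * (x + π) / 2 := by have := mul_pos hc (by linarith : 0 < x + π); linarith
  have hk1 : 0 < 1 - c * (x + π) / 2 := by nlinarith
  set a := bestCentre c l x with ha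
  -- The uncapped centre equalises the kernel at the two ends; the cap moves the interval left,
  -- which can only lower the left value and raise the right one.
  have hright : gapKernel c x (a - l) ≤ gapKernel c x (a + l) := by
    have hle : a ≤ x + l * (1 - c * (x + π)) := min_le_left _ _
    rw [gapKernel_of_le h3, gapKernel_of_ge h4]
    nlinarith
  refine ⟨fun y hy => ?_, fun y hy hyn => ?_⟩
  · rcases le_total y x with hyx | hyx
    · rw [gapKernel_of_le h3, gapKernel_of_le hyx]
      nlinarith [hy.1]
    · refine hright.trans_lt ?_
      rw [gapKernel_of_ge h4, gapKernel_of_ge hyx]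
      nlinarith [hy.2]
  · rcases lt_or_ge y (a - l) with hya | hya
    · rw [gapKernel_of_le h3, gapKernel_of_le (by linarith)]
      nlinarith
    · have hya' : a + l < y := by
        by_contra! hcon
        exact hyn ⟨hya, hcon⟩
      -- If the cap were active, the interval would end at `π` and leave no room for `y` on its
      -- right.
      have haeq : a = x + l * (1 - c * (x + π)) := by
        rcases min_cases (x + l * (1 - c * (x + π))) (π - l) with ⟨h, h'⟩ | ⟨h, h'⟩
        · exact h
        · have : a = π - l := h
          linarith [hy.2]
      have heq : gapKernel c x (a - l) = gapKernel c x (a + l) := by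
        rw [gapKernel_of_le h3, gapKernel_of_ge h4]
        linear_combination haeq
      rw [heq, gapKernel_of_ge h4, gapKernel_of_ge (by linarith)]
      nlinarith

end BestCentre

/-- Among all sources with the given bounds and mass, the one concentrated around the best centre
uniquely maximises the gap between `x` and `-π`. -/
theorem integral_gapKernel_mul_le {c l x m q : ℝ} (hl : 0 < l) (hlπ : l < π) (hc : 0 < c)
    (hcπ : c * π < 1) (hx : -π < x) (hxπ : x ≤ π) {f : ℝ → ℝ}
    (hf : IntegrableOn f (Icc (-π) π))
    (hb : ∀ᵐ y ∂(volume.restrict (Icc (-π) π)), m ≤ f y ∧ f y ≤ m + q)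
    (hmass : ∫ y in Icc (-π) π, f y = 2 * π * m + 2 * l * q) :
    ∫ y in Icc (-π) π, gapKernel c x y * f y ≤
        ∫ y in Icc (-π) π, gapKernel c x y * intervalSource m q (bestCentre c l x) l y ∧
      (∫ y in Icc (-π) π, gapKernel c x y * f y =
          ∫ y in Icc (-π) π, gapKernel c x y * intervalSource m q (bestCentre c l x) l y →
        f =ᵐ[volume.restrict (Icc (-π) π)] intervalSource m q (bestCentre c l x) l) := by
  obtain ⟨h1, h2, -, -⟩ := bestCentre_mem hl hlπ hc hcπ hx.le hxπ
  obtain ⟨hin, hout⟩ := gapKernel_level hl hlπ hc hcπ hx hxπ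
  have hcont : ContinuousOn (gapKernel c x) (Icc (-π) π) := (continuous_gapKernel c x).continuousOn
  have hg := integrableOn_intervalSource m q (bestCentre c l x) l
  refine integral_mul_le_of_bathtub (t := gapKernel c x (bestCentre c l x - l)) hf hg
    (hf.continuousOn_mul hcont isCompact_Icc) (hg.continuousOn_mul hcont isCompact_Icc)
    (by rw [hmass, integral_intervalSource m q hl.le h1 h2]) ?_
  -- The two ends of the interval are discarded, since strict inequality of the kernel can fail
  -- there.
  have hne (z : ℝ) : ∀ᵐ y ∂(volume.restrict (Icc (-π) π)), y ≠ z :=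
    ae_restrict_of_ae (by simp [ae_iff, measure_singleton])
  filter_upwards [hb, ae_restrict_mem measurableSet_Icc, hne (bestCentre c l x - l),
    hne (bestCentre c l x + l)] with y hy hyI hy1 hy2
  by_cases hyE : y ∈ Icc (bestCentre c l x - l) (bestCentre c l x + l)
  · have hv : intervalSource m q (bestCentre c l x) l y = m + q := by
      simp [intervalSource, indicator_of_mem hyE]
    rw [hv]
    rcases hy.2.eq_or_lt with h | h
    · exact Or.inl h
    · exact Or.inr (mul_pos (sub_pos.2 (hin y ⟨lt_of_le_of_ne hyE.1 hy1.symm,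
        lt_of_le_of_ne hyE.2 hy2⟩)) (sub_pos.2 h))
  · have hv : intervalSource m q (bestCentre c l x) l y = m := by
      simp [intervalSource, indicator_of_notMem hyE]
    rw [hv]
    rcases hy.1.eq_or_lt with h | h
    · exact Or.inl h.symm
    · exact Or.inr (mul_pos_of_neg_of_neg (sub_neg.2 (hout y hyI hyE)) (sub_neg.2 h))

/-! ### Maximising the quadratic, and the threshold. -/

section Parameters

variable {α l δ : ℝ}

theorem robinC_pos (hα : 0 < α) : 0 < robinC α := by
  have := pi_pos
  unfold robinC; positivity

theorem one_sub_robinC_mul_pi (hα : 0 < α) : 1 - robinC α * π = 1 / (1 + α * π) := by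
  have : 0 < 1 + α * π := by have := pi_pos; positivity
  unfold robinC
  field_simp
  ring

theorem robinC_mul_pi_lt_one (hα : 0 < α) : robinC α * π < 1 := by
  have h : 0 < 1 / (1 + α * π) := by have := pi_pos; positivity
  linarith [one_sub_robinC_mul_pi hα]

/-- The quantity equals `(1 + δ) - (1 - c * l) ^ 2`, the Hessian determinant of `gapQuad`; its
positivity is strict concavity. -/
theorem robin_discriminant_pos (hα : 0 < α) (hl : 0 < l) (hlπ : l < π) (hδ : 0 ≤ δ) :
    0 < δ + 2 * l * robinC α - l ^ 2 * robinC α ^ 2 := by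
  have hc := robinC_pos hα
  have hcl : l * robinC α < 1 := by nlinarith [robinC_mul_pi_lt_one hα]
  nlinarith [mul_pos hl hc]

/-- The threshold `α_g` decides on which side of `π - l` the stationary centre lies. -/
theorem robinAlphaG_spec (hα : 0 < α) (hl : 0 < l) (hlπ : l < π) (hδ : 0 ≤ δ) :
    (α ≤ robinAlphaG l δ → (π - l) * (δ + 2 * l * robinC α - l ^ 2 * robinC α ^ 2) ≤
      (1 + δ) * l * (1 - robinC α * π)) ∧
    (¬ α ≤ robinAlphaG l δ → (1 + δ) * l * (1 - robinC α * π) ≤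
      (π - l) * (δ + 2 * l * robinC α - l ^ 2 * robinC α ^ 2)) := by
  have hπ := pi_pos
  have hden : 0 < 1 + α * π := by positivity
  set E := (π - l) * (π ^ 2 * δ + 2 * π * l - l ^ 2) with hE
  set F := 2 * (π * δ + l) * (π - l) - π * (1 + δ) * l with hF
  set G := (π - l) * δ - (1 + δ) * l with hG
  -- After clearing denominators the comparison is the sign of a quadratic in `α`, whose larger root
  -- is `robinAlpha0`.
  have hkey : (π - l) * (δ + 2 * l * robinC α - l ^ 2 * robinC α ^ 2) -
      (1 + δ) * l * (1 - robinC α * π) = (E * α ^ 2 + F * α + G) / (1 + α * π) ^ 2 := by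
    rw [one_sub_robinC_mul_pi hα, robinC, hE, hF, hG]
    field_simp
    ring
  suffices H : (α ≤ robinAlphaG l δ → E * α ^ 2 + F * α + G ≤ 0) ∧
      (¬ α ≤ robinAlphaG l δ → 0 ≤ E * α ^ 2 + F * α + G) by
    refine ⟨fun h => ?_, fun h => ?_⟩
    · have := div_nonpos_of_nonpos_of_nonneg (H.1 h) (sq_nonneg (1 + α * π))
      linarith
    · have := div_nonneg (H.2 h) (sq_nonneg (1 + α * π))
      linarith
  have hEpos : 0 < E := by
    refine mul_pos (by linarith) ?_
    nlinarith [mul_nonneg (sq_nonneg π) hδ, mul_pos hl (sub_pos.2 hlπ), mul_pos hl hπ]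
  by_cases hcase : (1 + δ) * l > δ * (π - l)
  · have hGneg : G < 0 := by rw [hG]; linarith
    set S := (1 + δ) * (π ^ 2 * δ + 9 * π ^ 2 - 16 * π * l + 8 * l ^ 2) with hS
    have hSnn : 0 ≤ S := by
      refine mul_nonneg (by linarith) ?_
      nlinarith [mul_nonneg (sq_nonneg π) hδ, sq_nonneg (π - l), sq_nonneg π]
    set r := l * √S with hr
    have hr0 : 0 ≤ r := mul_nonneg hl.le (sqrt_nonneg S)
    have hrsq : r ^ 2 = F ^ 2 - 4 * E * G := by
      rw [hr, mul_pow, sq_sqrt hSnn, hS, hE, hF, hG]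
      ring
    have hα0 : robinAlphaG l δ = (-F + r) / (2 * E) := by
      rw [robinAlphaG, if_pos hcase, robinAlpha0, hE, hF, hr, hS]
      congr 1 <;> ring
    -- The smaller root `(-F - r) / (2 * E)` is negative, so for `α > 0` only the larger root
    -- matters.
    have hFr : -r < F := by nlinarith [mul_pos hEpos (neg_pos.2 hGneg)]
    rw [hα0, le_div_iff₀ (by positivity)]
    refine ⟨fun h => ?_, fun h => ?_⟩
    · nlinarith [mul_pos hEpos hα]
    · rw [not_le] at h
      nlinarith [mul_pos hEpos hα]
  · rw [robinAlphaG, if_neg hcase]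
    rw [gt_iff_lt, not_lt] at hcase
    refine ⟨fun h => absurd hα h.not_gt, fun _ => ?_⟩
    have hG0 : 0 ≤ G := by rw [hG]; linarith
    have hF0 : 0 ≤ F := by
      rw [hF]
      nlinarith [mul_le_mul_of_nonneg_left hcase hπ.le, mul_nonneg hπ.le (mul_nonneg hδ
        (sub_nonneg.2 hlπ.le)), mul_nonneg hl.le (sub_nonneg.2 hlπ.le)]
    have := mul_nonneg hEpos.le (sq_nonneg α)
    have := mul_nonneg hF0 hα.le
    linarith

/-- These are the first-order conditions for maximising `gapQuad` over `a ≤ π - l` once `x` is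
eliminated: the slope in `a` is nonnegative at `a_g`, and zero unless the constraint is active. The
last clause writes both branches of `Θ` as one expression in `a_g`. -/
theorem robinAG_spec (hα : 0 < α) (hl : 0 < l) (hlπ : l < π) (hδ : 0 ≤ δ) :
    0 < robinAG α l δ ∧ robinAG α l δ ≤ π - l ∧
    robinAG α l δ * (δ + 2 * l * robinC α - l ^ 2 * robinC α ^ 2) ≤
      (1 + δ) * l * (1 - robinC α * π) ∧
    (robinAG α l δ = π - l ∨ robinAG α l δ * (δ + 2 * l * robinC α - l ^ 2 * robinC α ^ 2) =
      (1 + δ) * l * (1 - robinC α * π)) ∧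
    robinTheta α l δ = π * l + π ^ 2 * δ / 2 - l ^ 2 / 2 + l * (1 - robinC α * π) * robinAG α l δ -
      (δ + 2 * l * robinC α - l ^ 2 * robinC α ^ 2) * robinAG α l δ ^ 2 / (2 * (1 + δ)) := by
  have hD := robin_discriminant_pos hα hl hlπ hδ
  have hden : 0 < 1 + α * π := by have := pi_pos; positivity
  have hδ1 : 0 < 1 + δ := by linarith
  obtain ⟨hs1, hs2⟩ := robinAlphaG_spec hα hl hlπ hδ
  by_cases hcase : α ≤ robinAlphaG l δ
  · have h : robinAG α l δ = π - l := by rw [robinAG, if_pos hcase]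
    rw [h]
    refine ⟨by linarith, le_rfl, hs1 hcase, Or.inl rfl, ?_⟩
    rw [robinTheta, if_pos hcase, one_sub_robinC_mul_pi hα]
    field_simp
    ring
  · have h : robinAG α l δ = robinA0 α l δ := by rw [robinAG, if_neg hcase]
    have hmul : robinAG α l δ * (δ + 2 * l * robinC α - l ^ 2 * robinC α ^ 2) =
        (1 + δ) * l * (1 - robinC α * π) := by
      rw [h, robinA0, one_sub_robinC_mul_pi hα]
      generalize δ + 2 * l * robinC α - l ^ 2 * robinC α ^ 2 = D at hD
      field_simp
    have hpos : 0 < robinAG α l δ := by rw [h, robinA0]; positivity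
    refine ⟨hpos, ?_, hmul.le, Or.inr hmul, ?_⟩
    · have := hs2 hcase
      rw [← hmul] at this
      exact le_of_mul_le_mul_right this hD
    · have hQ : (π ^ 2 * δ + 2 * π * l - l ^ 2) * α ^ 2 + 2 * (π * δ + l) * α + δ =
          (1 + α * π) ^ 2 * (δ + 2 * l * robinC α - l ^ 2 * robinC α ^ 2) := by
        rw [robinC]
        field_simp
        ring
      rw [robinTheta, if_neg hcase, hQ, h, robinA0, one_sub_robinC_mul_pi hα]
      field_simp
      ring

/-- The point where the source concentrated around `a_g` produces its largest temperature. -/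
noncomputable def hotSpot (α l δ : ℝ) : ℝ := (1 - robinC α * l) * robinAG α l δ / (1 + δ)

theorem hotSpot_mem (hα : 0 < α) (hl : 0 < l) (hlπ : l < π) (hδ : 0 ≤ δ) :
    -π < hotSpot α l δ ∧ hotSpot α l δ ≤ π := by
  obtain ⟨h1, h2, -⟩ := robinAG_spec hα hl hlπ hδ
  have hc := robinC_pos hα
  have hcl : robinC α * l < 1 := by nlinarith [robinC_mul_pi_lt_one hα]
  have hx : 0 < hotSpot α l δ := div_pos (mul_pos (by linarith) h1) (by linarith)
  refine ⟨by linarith, ?_⟩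
  rw [hotSpot, div_le_iff₀ (by linarith)]
  nlinarith [mul_pos hc hl, mul_pos (mul_pos hc hl) h1, mul_nonneg hδ pi_pos.le]

theorem bestCentre_hotSpot (hα : 0 < α) (hl : 0 < l) (hlπ : l < π) (hδ : 0 ≤ δ) :
    bestCentre (robinC α) l (hotSpot α l δ) = robinAG α l δ := by
  obtain ⟨-, h2, h3, h4, -⟩ := robinAG_spec hα hl hlπ hδ
  have hδ1 : 0 < 1 + δ := by linarith
  have e : hotSpot α l δ + l * (1 - robinC α * (hotSpot α l δ + π)) = robinAG α l δ +
      ((1 + δ) * l * (1 - robinC α * π) -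
        robinAG α l δ * (δ + 2 * l * robinC α - l ^ 2 * robinC α ^ 2)) / (1 + δ) := by
    rw [hotSpot]
    field_simp
    ring
  have hnn := div_nonneg (sub_nonneg.2 h3) hδ1.le
  rw [bestCentre, e]
  rcases h4 with h4 | h4
  · rw [min_eq_right (by linarith), h4]
  · rw [h4, sub_self, zero_div, add_zero, min_eq_left h2]

/-- The gap function is maximised exactly at `(hotSpot, a_g)`, with maximal value `Θ`. -/
theorem gapQuad_le (hα : 0 < α) (hl : 0 < l) (hlπ : l < π) (hδ : 0 ≤ δ) {x a : ℝ}
    (ha : a ≤ π - l) :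
    π * l + π ^ 2 * δ / 2 - l ^ 2 / 2 + gapQuad (robinC α) l δ x a ≤ robinTheta α l δ ∧
    (π * l + π ^ 2 * δ / 2 - l ^ 2 / 2 + gapQuad (robinC α) l δ x a = robinTheta α l δ →
      x = hotSpot α l δ ∧ a = robinAG α l δ) := by
  obtain ⟨-, -, h3, h4, h5⟩ := robinAG_spec hα hl hlπ hδ
  have hD := robin_discriminant_pos hα hl hlπ hδ
  have hδ1 : 0 < 1 + δ := by linarith
  set c := robinC α
  set A := robinAG α l δ with hA
  set D := δ + 2 * l * c - l ^ 2 * c ^ 2 with hDdef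
  set X := hotSpot α l δ with hX
  -- `s` is the linear term of the expansion of `gapQuad` at `(X, A)`; the slope in `x` vanishes
  -- there.
  set s := ((1 + δ) * l * (1 - c * π) - A * D) / (1 + δ) * (a - A) with hs
  have hs0 : s ≤ 0 := by
    rcases h4 with h4 | h4
    · exact mul_nonpos_of_nonneg_of_nonpos (div_nonneg (by linarith) hδ1.le) (by linarith)
    · rw [hs, h4]; simp
  have key : π * l + π ^ 2 * δ / 2 - l ^ 2 / 2 + gapQuad c l δ x a = robinTheta α l δ + s -
      (((a - A) - (1 - c * l) * (x - X)) ^ 2 + D * (x - X) ^ 2) / 2 := by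
    have hXv : X = (1 - c * l) * A / (1 + δ) := rfl
    rw [h5, hs, gapQuad, hXv, hDdef]
    field_simp
    ring
  have hq1 := sq_nonneg ((a - A) - (1 - c * l) * (x - X))
  have hq2 := mul_nonneg hD.le (sq_nonneg (x - X))
  refine ⟨by linarith, fun heq => ?_⟩
  have e2 : D * (x - X) ^ 2 = 0 := by linarith
  have e1 : ((a - A) - (1 - c * l) * (x - X)) ^ 2 = 0 := by linarith
  have hx : x - X = 0 := by
    rcases mul_eq_zero.1 e2 with h | h
    · exact absurd h hD.ne'
    · exact pow_eq_zero_iff (two_ne_zero) |>.1 h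
  have hy := pow_eq_zero_iff (two_ne_zero) |>.1 e1
  rw [hx, mul_zero, sub_zero] at hy
  exact ⟨by linarith, by linarith⟩

theorem gapQuad_hotSpot (hα : 0 < α) (hl : 0 < l) (hlπ : l < π) (hδ : 0 ≤ δ) :
    π * l + π ^ 2 * δ / 2 - l ^ 2 / 2 + gapQuad (robinC α) l δ (hotSpot α l δ) (robinAG α l δ) =
      robinTheta α l δ := by
  obtain ⟨-, -, -, -, h5⟩ := robinAG_spec hα hl hlπ hδ
  have hδ1 : 0 < 1 + δ := by linarith
  rw [h5, gapQuad, hotSpot]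
  field_simp
  ring

end Parameters

/-! ### Reflection, oscillation and the final bound. -/

theorem setIntegral_Icc_neg_pi_pi (g : ℝ → ℝ) :
    ∫ y in Icc (-π) π, g y = ∫ y in (-π)..π, g y := by
  rw [integral_Icc_eq_integral_Ioc, intervalIntegral.integral_of_le (by linarith [pi_pos])]

theorem measurePreserving_neg_Icc_pi :
    MeasurePreserving (fun y : ℝ => -y) (volume.restrict (Icc (-π) π))
      (volume.restrict (Icc (-π) π)) := by
  have h := (Measure.measurePreserving_neg (volume : Measure ℝ)).restrict_preimage
    (s := Icc (-π) π) measurableSet_Icc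
  have e : Neg.neg ⁻¹' Icc (-π) π = Icc (-π) π := by
    ext y
    simp only [mem_preimage, mem_Icc]
    constructor <;> rintro ⟨h1, h2⟩ <;> constructor <;> linarith
  rwa [e] at h

theorem ae_comp_neg_Icc_pi {P : ℝ → Prop} (h : ∀ᵐ y ∂(volume.restrict (Icc (-π) π)), P y) :
    ∀ᵐ y ∂(volume.restrict (Icc (-π) π)), P (-y) :=
  measurePreserving_neg_Icc_pi.quasiMeasurePreserving.ae h

section

variable {α m M s l δ : ℝ} {f u : ℝ → ℝ}

theorem IsHeatSource.intervalIntegrable (h : IsHeatSource m M s f) :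
    IntervalIntegrable f volume (-π) π :=
  (intervalIntegrable_iff_integrableOn_Icc_of_le (by linarith [pi_pos])).2 h.integrableOn

theorem IsHeatSource.comp_neg (h : IsHeatSource m M s f) :
    IsHeatSource m M s (fun y => f (-y)) where
  integrableOn := measurePreserving_neg_Icc_pi.integrable_comp_of_integrable h.integrableOn
  bounds := ae_comp_neg_Icc_pi h.bounds
  norm_eq := by
    rw [← h.norm_eq]
    exact measurePreserving_neg_Icc_pi.integral_comp (MeasurableEquiv.neg ℝ).measurableEmbedding
      (fun y => |f y|)

theorem IsHeatSource.integral_eq (h : IsHeatSource m M s f) (hm : 0 ≤ m) :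
    ∫ y in Icc (-π) π, f y = 2 * π * s := by
  rw [← h.norm_eq]
  refine integral_congr_ae ?_
  filter_upwards [h.bounds] with y hy
  exact (abs_of_nonneg (hm.trans hy.1)).symm

theorem isHeatSource_intervalSource {p q a l : ℝ} (hp : 0 ≤ p) (hq : 0 ≤ q) (hl : 0 ≤ l)
    (h1 : -π ≤ a - l) (h2 : a + l ≤ π) :
    IsHeatSource p (p + q) (p + q * l / π) (intervalSource p q a l) := by
  have hb (y : ℝ) : p ≤ intervalSource p q a l y ∧ intervalSource p q a l y ≤ p + q := by
    by_cases hy : y ∈ Icc (a - l) (a + l)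
    · simp [intervalSource, indicator_of_mem hy, hq]
    · simp [intervalSource, indicator_of_notMem hy, hq]
  refine ⟨integrableOn_intervalSource p q a l, Filter.Eventually.of_forall hb, ?_⟩
  simp only [fun y => abs_of_nonneg (hp.trans (hb y).1)]
  rw [integral_intervalSource p q hl h1 h2]
  have := pi_pos
  field_simp

theorem IsRobinSolution.sub_left_eq_integral (hα : 0 < α)
    (hf : IntervalIntegrable f volume (-π) π) (h : IsRobinSolution α f u) {x : ℝ}
    (hx : x ∈ Icc (-π) π) :
    u x - u (-π) = ∫ y in Icc (-π) π, gapKernel (robinC α) x y * f y := by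
  have hππ : -π ≤ π := by linarith [pi_pos]
  have hint (x : ℝ) : IntervalIntegrable (fun y => robinGreen α x y * f y) volume (-π) π :=
    hf.continuousOn_mul (continuous_robinGreen α x).continuousOn
  rw [setIntegral_Icc_neg_pi_pi, h.eq_integral_robinGreen hα hf hx,
    h.eq_integral_robinGreen hα hf ⟨le_rfl, hππ⟩, ← intervalIntegral.integral_sub (hint _) (hint _)]
  apply intervalIntegral.integral_congr
  intro y hy
  rw [uIcc_of_le hππ] at hy
  simp only [robinGreen, gapKernel, abs_of_nonpos (by linarith [hy.1] : -π - y ≤ 0)]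
  ring

theorem IsRobinSolution.sub_right_eq_integral (hα : 0 < α)
    (hf : IntervalIntegrable f volume (-π) π) (h : IsRobinSolution α f u) {x : ℝ}
    (hx : x ∈ Icc (-π) π) :
    u x - u π = ∫ y in Icc (-π) π, gapKernel (robinC α) (-x) y * f (-y) := by
  have hππ : -π ≤ π := by linarith [pi_pos]
  have hint (x : ℝ) : IntervalIntegrable (fun y => robinGreen α x y * f y) volume (-π) π :=
    hf.continuousOn_mul (continuous_robinGreen α x).continuousOn
  have hneg := intervalIntegral.integral_comp_neg (a := -π) (b := π)
    (fun y => gapKernel (robinC α) (-x) (-y) * f y)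
  simp only [neg_neg] at hneg
  rw [setIntegral_Icc_neg_pi_pi, hneg, h.eq_integral_robinGreen hα hf hx,
    h.eq_integral_robinGreen hα hf ⟨hππ, le_rfl⟩, ← intervalIntegral.integral_sub (hint _) (hint _)]
  apply intervalIntegral.integral_congr
  intro y hy
  rw [uIcc_of_le hππ] at hy
  have e : |-x - -y| = |x - y| := by rw [← abs_neg]; congr 1; ring
  simp only [robinGreen, gapKernel, e, abs_of_nonneg (by linarith [hy.2] : 0 ≤ π - y)]
  ring

theorem exists_rodOsc_eq_sub (hu : ContinuousOn u (Icc (-π) π)) :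
    ∃ x ∈ Icc (-π) π, ∃ t ∈ Icc (-π) π, rodOsc u = u x - u t := by
  have hne : (Icc (-π) π).Nonempty := nonempty_Icc.2 (by linarith [pi_pos])
  obtain ⟨x, hx, hmax⟩ := isCompact_Icc.exists_isMaxOn hne hu
  obtain ⟨t, ht, hmin⟩ := isCompact_Icc.exists_isMinOn hne hu
  refine ⟨x, hx, t, ht, ?_⟩
  have h1 : IsGreatest (u '' Icc (-π) π) (u x) :=
    ⟨mem_image_of_mem u hx, by rintro _ ⟨y, hy, rfl⟩; exact hmax hy⟩
  have h2 : IsLeast (u '' Icc (-π) π) (u t) :=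
    ⟨mem_image_of_mem u ht, by rintro _ ⟨y, hy, rfl⟩; exact hmin hy⟩
  rw [rodOsc, h1.csSup_eq, h2.csInf_eq]

theorem sub_le_rodOsc (hu : ContinuousOn u (Icc (-π) π)) {x t : ℝ} (hx : x ∈ Icc (-π) π)
    (ht : t ∈ Icc (-π) π) : u x - u t ≤ rodOsc u :=
  sub_le_sub (le_csSup (isCompact_Icc.image_of_continuousOn hu).bddAbove (mem_image_of_mem u hx))
    (csInf_le (isCompact_Icc.image_of_continuousOn hu).bddBelow (mem_image_of_mem u ht))

/-- Comparison with `x = a = 0`, where `gapQuad` vanishes. Positivity excludes equality at the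
degenerate point `x = -π`. -/
theorem robinTheta_pos (hα : 0 < α) (hl : 0 < l) (hlπ : l < π) (hδ : 0 ≤ δ) :
    0 < robinTheta α l δ := by
  have h := (gapQuad_le hα hl hlπ hδ (x := 0) (a := 0) (by linarith)).1
  have h0 : gapQuad (robinC α) l δ 0 0 = 0 := by simp [gapQuad]
  rw [h0] at h
  nlinarith [mul_nonneg (sq_nonneg π) hδ, mul_pos hl (sub_pos.2 hlπ), mul_pos hl pi_pos]

/-- The source concentrated around `a_g` produces the gap `Θ` between its hot spot and `-π`. -/
theorem integral_gapKernel_hotSpot (hα : 0 < α) (hl : 0 < l) (hlπ : l < π) (hδ : 0 ≤ δ) (q : ℝ) :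
    ∫ y in Icc (-π) π, gapKernel (robinC α) (hotSpot α l δ) y *
      intervalSource (q * δ) q (robinAG α l δ) l y = q * robinTheta α l δ := by
  obtain ⟨hx, hxπ⟩ := hotSpot_mem hα hl hlπ hδ
  obtain ⟨h1, h2, h3, h4⟩ :=
    bestCentre_mem hl hlπ (robinC_pos hα) (robinC_mul_pi_lt_one hα) hx.le hxπ
  rw [bestCentre_hotSpot hα hl hlπ hδ] at h1 h2 h3 h4
  rw [integral_gapKernel_mul_intervalSource _ _ _ hl.le h1 h2 h3 h4,
    gapQuad_hotSpot hα hl hlπ hδ]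

/-- No source of the class produces a gap between a point and `-π` larger than that of the source
concentrated around `a_g`, which is the only one to attain it. -/
theorem integral_gapKernel_le {q x : ℝ} (hα : 0 < α) (hl : 0 < l) (hlπ : l < π) (hδ : 0 ≤ δ)
    (hq : 0 < q) (hx : x ∈ Icc (-π) π) (hf : IntegrableOn f (Icc (-π) π))
    (hb : ∀ᵐ y ∂(volume.restrict (Icc (-π) π)), q * δ ≤ f y ∧ f y ≤ q * δ + q)
    (hmass : ∫ y in Icc (-π) π, f y = 2 * π * (q * δ) + 2 * l * q) :
    ∫ y in Icc (-π) π, gapKernel (robinC α) x y * f y ≤ q * robinTheta α l δ ∧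
      (∫ y in Icc (-π) π, gapKernel (robinC α) x y * f y = q * robinTheta α l δ →
        f =ᵐ[volume.restrict (Icc (-π) π)] intervalSource (q * δ) q (robinAG α l δ) l) := by
  have hc := robinC_pos hα
  have hcπ := robinC_mul_pi_lt_one hα
  rcases hx.1.eq_or_lt with rfl | hx1
  -- At `x = -π` the kernel vanishes identically and has no strict superlevel intervals.
  · have h0 : ∫ y in Icc (-π) π, gapKernel (robinC α) (-π) y * f y = 0 := by
      rw [setIntegral_congr_fun (g := fun _ => (0 : ℝ)) measurableSet_Icc]
      · simp
      · intro y hy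
        simp only [gapKernel_of_ge hy.1]
        ring
    have hpos := mul_pos hq (robinTheta_pos hα hl hlπ hδ)
    rw [h0]
    exact ⟨hpos.le, fun h => absurd h hpos.ne⟩
  · obtain ⟨hle, heq⟩ := integral_gapKernel_mul_le hl hlπ hc hcπ hx1 hx.2 hf hb hmass
    obtain ⟨h1, h2, h3, h4⟩ := bestCentre_mem hl hlπ hc hcπ hx.1 hx.2
    rw [integral_gapKernel_mul_intervalSource _ _ _ hl.le h1 h2 h3 h4] at hle heq
    obtain ⟨hle2, heq2⟩ := gapQuad_le hα hl hlπ hδ (x := x)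
      (a := bestCentre (robinC α) l x) (by linarith)
    have hle3 := mul_le_mul_of_nonneg_left hle2 hq.le
    refine ⟨hle.trans hle3, fun h => ?_⟩
    -- Equality forces equality in both steps: the quadratic bound identifies the centre, then the
    -- bathtub bound identifies `f`.
    have e1 := le_antisymm hle3 (h ▸ hle)
    have e2 := heq2 (mul_left_cancel₀ hq.ne' e1)
    rw [← e2.2]
    exact heq (h.trans e1.symm)

theorem IsHeatSource.rodOsc_le (hα : 0 < α) (hm : 0 ≤ m) (hms : m < s) (hsM : s < M)
    (hl : l = π * (s - m) / (M - m)) (hδ : δ = m / (M - m))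
    (hf : IsHeatSource m M s f) (hu : IsRobinSolution α f u) :
    rodOsc u ≤ (M - m) * robinTheta α l δ ∧
      (rodOsc u = (M - m) * robinTheta α l δ ↔
        (f =ᵐ[volume.restrict (Icc (-π) π)]
            intervalSource m (M - m) (robinAG α l δ) l) ∨
        (f =ᵐ[volume.restrict (Icc (-π) π)]
            fun x => intervalSource m (M - m) (robinAG α l δ) l (-x))) := by
  have hπ := pi_pos
  have hq : 0 < M - m := by linarith
  have hl0 : 0 < l := by rw [hl]; exact div_pos (mul_pos hπ (by linarith)) hq
  have hlπ : l < π := by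
    rw [hl, div_lt_iff₀ hq]
    exact mul_lt_mul_of_pos_left (by linarith) hπ
  have hδ0 : 0 ≤ δ := by rw [hδ]; exact div_nonneg hm hq.le
  have hmq : (M - m) * δ = m := by rw [hδ]; field_simp
  have hlq : 2 * l * (M - m) = 2 * π * (s - m) := by rw [hl]; field_simp
  have hmass {g : ℝ → ℝ} (hg : IsHeatSource m M s g) :
      ∫ y in Icc (-π) π, g y = 2 * π * ((M - m) * δ) + 2 * l * (M - m) := by
    rw [hg.integral_eq hm, hmq, hlq]; ring
  have hbd {g : ℝ → ℝ} (hg : IsHeatSource m M s g) : ∀ᵐ y ∂(volume.restrict (Icc (-π) π)),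
      (M - m) * δ ≤ g y ∧ g y ≤ (M - m) * δ + (M - m) := by
    rw [hmq]
    simpa using hg.bounds
  have hcont := hu.contDiffOn.continuousOn
  have hl_mem : -π ∈ Icc (-π) π := ⟨le_rfl, by linarith⟩
  have hr_mem : π ∈ Icc (-π) π := ⟨by linarith, le_rfl⟩
  have hneg_mem {x : ℝ} (hx : x ∈ Icc (-π) π) : -x ∈ Icc (-π) π :=
    ⟨by linarith [hx.2], by linarith [hx.1]⟩
  have hrightEq {x : ℝ} (hx : x ∈ Icc (-π) π) :=
    hu.sub_right_eq_integral hα hf.intervalIntegrable hx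
  have hspot := integral_gapKernel_hotSpot hα hl0 hlπ hδ0 (M - m)
  rw [hmq] at hspot
  have hspot_mem : hotSpot α l δ ∈ Icc (-π) π :=
    ⟨(hotSpot_mem hα hl0 hlπ hδ0).1.le, (hotSpot_mem hα hl0 hlπ hδ0).2⟩
  obtain ⟨x, hx, t, ht, hosc⟩ := exists_rodOsc_eq_sub hcont
  have hmin := hu.min_endpoints_le hα hf.intervalIntegrable
    (hf.bounds.mono fun y hy => hm.trans hy.1) ht
  have hLx := hu.sub_left_eq_integral hα hf.intervalIntegrable hx
  have hRx := hrightEq hx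
  obtain ⟨hL1, hL2⟩ := integral_gapKernel_le hα hl0 hlπ hδ0 hq hx
    hf.integrableOn (hbd hf) (hmass hf)
  obtain ⟨hR1, hR2⟩ := integral_gapKernel_le hα hl0 hlπ hδ0 hq
    (hneg_mem hx) hf.comp_neg.integrableOn (hbd hf.comp_neg) (hmass hf.comp_neg)
  rw [← hLx] at hL1 hL2
  rw [← hRx] at hR1 hR2
  rw [hmq] at hL2 hR2
  have hle : rodOsc u ≤ (M - m) * robinTheta α l δ := by
    rcases hmin with h | h <;> linarith
  refine ⟨hle, fun heq => ?_, ?_⟩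
  · rcases hmin with h | h
    · exact Or.inl (hL2 (by linarith))
    · refine Or.inr ?_
      have := ae_comp_neg_Icc_pi (hR2 (by linarith))
      filter_upwards [this] with y hy
      simpa using hy
  · rintro (h | h)
    · refine le_antisymm hle ?_
      rw [← hspot, ← integral_congr_ae (h.mono fun y hy => by
          show gapKernel (robinC α) (hotSpot α l δ) y * f y = _; rw [hy]),
        ← hu.sub_left_eq_integral hα hf.intervalIntegrable hspot_mem]
      exact sub_le_rodOsc hcont hspot_mem hl_mem
    · refine le_antisymm hle ?_
      have h' := ae_comp_neg_Icc_pi h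
      have hR := hrightEq (hneg_mem hspot_mem)
      rw [neg_neg] at hR
      rw [← hspot, ← integral_congr_ae (h'.mono fun y hy => by
          show gapKernel (robinC α) (hotSpot α l δ) y * f (-y) = _; simp only [hy, neg_neg]), ← hR]
      exact sub_le_rodOsc hcont (hneg_mem hspot_mem) hr_mem

end

theorem theorem1 (α m M s l δ : ℝ) (hα : 0 < α) (hm : 0 ≤ m) (hms : m < s) (hsM : s < M)
    (hl : l = π * (s - m) / (M - m)) (hδ : δ = m / (M - m)) :
    -- `Θ_α(l, δ)` is the largest temperature gap produced by the sources `δ + χ_{I(a, l)}`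
    IsGreatest
        {t : ℝ | ∃ a ∈ Icc 0 (π - l), ∃ u : ℝ → ℝ,
          IsRobinSolution α (intervalSource δ 1 a l) u ∧ rodOsc u = t}
        (robinTheta α l δ) ∧
    -- the bound for all sources of the class, with the cases of equality
    ∀ f u : ℝ → ℝ, IsHeatSource m M s f → IsRobinSolution α f u →
      rodOsc u ≤ (M - m) * robinTheta α l δ ∧
      (rodOsc u = (M - m) * robinTheta α l δ ↔
        (f =ᵐ[volume.restrict (Icc (-π) π)]
            intervalSource m (M - m) (robinAG α l δ) l) ∨
        (f =ᵐ[volume.restrict (Icc (-π) π)]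
            fun x => intervalSource m (M - m) (robinAG α l δ) l (-x))) := by
  have hπ := pi_pos
  refine ⟨?_, fun f u hf hu => hf.rodOsc_le hα hm hms hsM hl hδ hu⟩
  have hq : 0 < M - m := by linarith
  have hl0 : 0 < l := by rw [hl]; exact div_pos (mul_pos hπ (by linarith)) hq
  have hlπ : l < π := by
    rw [hl, div_lt_iff₀ hq]
    exact mul_lt_mul_of_pos_left (by linarith) hπ
  have hδ0 : 0 ≤ δ := by rw [hδ]; exact div_nonneg hm hq.le
  -- The source `δ + χ_{I(a,l)}` belongs to the class with bounds `δ`, `δ + 1` and mean `δ + l / π`,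
  -- whose parameters are again `l` and `δ`; the general bound thus covers the single-interval
  -- problem.
  have hone {a : ℝ} (ha : a ∈ Icc 0 (π - l)) {u : ℝ → ℝ}
      (hu : IsRobinSolution α (intervalSource δ 1 a l) u) :=
    (isHeatSource_intervalSource hδ0 zero_le_one hl0.le (by linarith [ha.1])
      (by linarith [ha.2])).rodOsc_le (l := l) (δ := δ) hα hδ0
      (lt_add_of_pos_right δ (by positivity))
      (by rw [one_mul]; linarith [(div_lt_one hπ).2 hlπ]) (by field_simp; ring) (by simp) hu
  simp only [add_sub_cancel_left, one_mul] at hone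
  obtain ⟨hA0, hAl, -⟩ := robinAG_spec hα hl0 hlπ hδ0
  refine ⟨⟨robinAG α l δ, ⟨hA0.le, hAl⟩, ?_⟩, ?_⟩
  · obtain ⟨u, hu⟩ := exists_isRobinSolution hα
      (locallyIntegrable_intervalSource δ 1 (robinAG α l δ) l)
    exact ⟨u, hu, (hone ⟨hA0.le, hAl⟩ hu).2.2 (Or.inl (Filter.EventuallyEq.refl _ _))⟩
  · rintro _ ⟨a, ha, u, hu, rfl⟩
    exact (hone ha hu).1
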